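/- Let $\mathcal S$ be a triangulated category with suspension $\Sigma$. A *good metric* on $\mathcal S$ is a sequence $\{\mathcal M_i,\ i\in\mathbb N\}$ of full subcategories containing $0$ with $\Sigma^{-1}\mathcal M_{i+1}\cup\mathcal M_{i+1}\cup\Sigma\mathcal M_{i+1}\subset\mathcal M_i$ and $\mathcal M_i*\mathcal M_i\subset\mathcal M_i$ (if $b\to x\to b'\to\Sigma b$ is a distinguished triangle with $b,b'\in\mathcal M_i$, then $x\in\mathcal M_i$). A sequence $a_*=(a_1\to a_2\to\cdots)$ in $\mathcal S$ is *Cauchy* if for every $n$ there is $N$ such that for all $j>i\ge N$, in every distinguished triangle $a_i\to a_j\to d\to\Sigma a_i$, we have $d\in\mathcal M_n$. For a class $\mathcal A$ of objects, ${}^\perp\mathcal A$ (resp. $\mathcal A^\perp$) is the class of objects $X$ with $\mathrm{Hom}(X,A)=0$ (resp. $\mathrm{Hom}(A,X)=0$) for all $A\in\mathcal A$. Let $\mathrm{Mod}\text{-}\mathcal S$ be the category of additive functors $\mathcal S^{\mathrm{op}}\to\mathrm{Ab}$ and $Y:\mathcal S\to\mathrm{Mod}\text{-}\mathcal S$ the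 Yoneda embedding. Let $\mathfrak L(\mathcal S)\subset\mathrm{Mod}\text{-}\mathcal S$ be the full subcategory of objects isomorphic to $\mathrm{colim}\,Y(a_*)$ with $a_*$ Cauchy, $\mathcal L_i\subset\mathfrak L(\mathcal S)$ that of those for which $a_*$ can be chosen in $\mathcal M_i$, $\mathfrak C(\mathcal S)=\bigcup_i Y(\mathcal M_i)^\perp$, and $\mathfrak S(\mathcal S)=\mathfrak L(\mathcal S)\cap\mathfrak C(\mathcal S)$. A map $f_*:a_*\to b_*$ of Cauchy sequences is *of type $m$* if, for every completion to a sequence of distinguished triangles $a_*\to b_*\to c_*\to\Sigma a_*$ with $c_*$ Cauchy, $c_i\in\mathcal M_m$ for all $i\gg0$. If $A=\mathrm{colim}\,Y(a_*)$ and $B=\mathrm{colim}\,Y(b_*)$, a morphism $\varphi:A\to B$ is *of type $m$ with respect to $(a_*,b_*)$* if $\varphi=\mathrm{colim}\,Y(f_*)$ for some type-$m$ map $f_*$ from a subsequence of $a_*$ to a subsequence of $b_*$. A good metric is *very good* if 1. $\mathcal S=\bigcup_i{}^\perp\mathcal M_i$; and 2. for every $m$ there is $n>m$ such that every $X\in\mathcal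 S$ admits a distinguished triangle $E\to X\to D\to\Sigma E$ with $E\in{}^\perp\mathcal M_n$ and $D\in\mathcal M_m$. It is *excellent* if moreover 3. for every $m$ there is $n>m$ such that every $X\in\mathcal S$ admits a Cauchy sequence $d_*$ with colimit $D=\mathrm{colim}\,Y(d_*)\in\mathfrak S(\mathcal S)\cap\mathcal L_n^\perp$ and a morphism $Y(X)\to D$ of type $m$ with respect to $(X,d_*)$, where $X$ denotes the constant sequence. A fully faithful triangulated functor $F:\mathcal S\to\mathcal T$ is a *good extension* with respect to the metric if, for every Cauchy sequence $a_*$ in $\mathcal S$, the coproduct $\coprod_iF(a_i)$ exists in $\mathcal T$ and the natural map $\mathrm{colim}\,Y(a_*)\to\mathcal Y(\mathrm{Hocolim}\,F(a_*))$ is an isomorphism, where $\mathcal Y:\mathcal T\to\mathrm{Mod}\text{-}\mathcal S$ is $t\mapsto\mathrm{Hom}(F(-),t)$. Let $\mathfrak L'(\mathcal S)\subset\mathcal T$ be the full subcategory of objects isomorphic to $\mathrm{Hocolim}\,F(a_*)$ with $a_*$ Cauchy, and $\mathcal L'_i$ that of those for which $a_*$ can be chosen in $\mathcal M_i$. The functor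 $\mathcal Y$ restricts to an equivalence of $\mathfrak L'(\mathcal S)\cap\mathcal Y^{-1}(\mathfrak C(\mathcal S))$ with $\mathfrak S(\mathcal S)$, and $\mathfrak S(\mathcal S)$ is identified with this subcategory of $\mathfrak L'(\mathcal S)$. **Proposition.** Let $\{\mathcal M_i,\ i\in\mathbb N\}$ be a very good metric on a triangulated category $\mathcal S$ such that each $\mathcal M_i$ is closed in $\mathcal S$ under direct summands, and let $F:\mathcal S\to\mathcal T$ be a good extension with respect to the metric. Then the metric is excellent if and only if for every integer $m>0$ there exists an integer $n>0$ such that every object $B\in\mathcal S$ admits a distinguished triangle $A\to F(B)\to C\to\Sigma A$ of $\mathcal T$, with all three objects in $\mathfrak L'(\mathcal S)$, such that $A\in\mathcal L'_m$ and $C\in\mathfrak S(\mathcal S)\cap(\mathcal L'_n)^\perp$. -/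

import Mathlib

open CategoryTheory CategoryTheory.Limits CategoryTheory.Pretriangulated Opposite

universe v u₁ u₂

namespace MetricTriang

section Metric

variable {S : Type u₁} [Category.{v} S] [HasZeroObject S] [HasShift S ℤ] [Preadditive S]
  [∀ n : ℤ, (shiftFunctor S n).Additive] [Pretriangulated S]

/-- A good metric on a triangulated category: a sequence of full subcategories `M i`
containing `0`, with `Σ⁻¹ M (i+1) ∪ M (i+1) ∪ Σ M (i+1) ⊆ M i` and `M i * M i ⊆ M i`.
(It follows that each `M i` is closed under isomorphisms.) -/
structure IsGoodMetric (M : ℕ → ObjectProperty S) : Prop where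
  zero : ∀ i, (M i).ContainsZero
  shift_neg : ∀ i X, M (i + 1) X → M i (X⟦(-1 : ℤ)⟧)
  anti : ∀ i X, M (i + 1) X → M i X
  shift_pos : ∀ i X, M (i + 1) X → M i (X⟦(1 : ℤ)⟧)
  ext : ∀ i, ∀ T ∈ distTriang S, M i T.obj₁ → M i T.obj₃ → M i T.obj₂

/-- A sequence `a 0 ⟶ a 1 ⟶ a 2 ⟶ ⋯` is Cauchy if for every `n` there is `N` such that
for all `N ≤ i < j`, in every triangle `a i ⟶ a j ⟶ D ⟶ Σ (a i)` one has `D ∈ M n`. -/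
def IsCauchy (M : ℕ → ObjectProperty S) (a : ℕ ⥤ S) : Prop :=
  ∀ n : ℕ, ∃ N : ℕ, ∀ (i j : ℕ) (hij : i < j), N ≤ i →
    ∀ (D : S) (g : a.obj j ⟶ D) (h : D ⟶ (a.obj i)⟦(1 : ℤ)⟧),
      Triangle.mk (a.map (homOfLE hij.le)) g h ∈ distTriang S → M n D

/-- A very good metric: a good metric such that `S` is the union of the `⊥(M i)`, and for every
`m` there is `n > m` such that every `X` fits into a triangle `E ⟶ X ⟶ D ⟶ Σ E` with
`E ∈ ⊥(M n)` and `D ∈ M m`. -/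
structure IsVeryGoodMetric (M : ℕ → ObjectProperty S) : Prop extends IsGoodMetric M where
  exhaust : ∀ X : S, ∃ i, (M i).leftOrthogonal X
  approx : ∀ m : ℕ, ∃ n : ℕ, m < n ∧ ∀ X : S,
    ∃ (E D : S) (f : E ⟶ X) (g : X ⟶ D) (h : D ⟶ E⟦(1 : ℤ)⟧),
      Triangle.mk f g h ∈ distTriang S ∧ (M n).leftOrthogonal E ∧ M m D

/-- The subcategories `M i` are closed under direct summands. -/
def SummandClosed (M : ℕ → ObjectProperty S) : Prop :=
  ∀ (i : ℕ) (X X' : S), M i (X ⊞ X') → M i X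

/-- `f, g, h` form a Cauchy sequence of distinguished triangles
`a_* ⟶ b_* ⟶ c_* ⟶ Σ a_*` completing `f : a_* ⟶ b_*` (`a` and `b` being Cauchy). -/
structure IsCompletion (M : ℕ → ObjectProperty S) {a b c : ℕ ⥤ S} (f : a ⟶ b) (g : b ⟶ c)
    (h : c ⟶ a ⋙ shiftFunctor S (1 : ℤ)) : Prop where
  cauchy : IsCauchy M c
  dist : ∀ i, Triangle.mk (f.app i) (g.app i) (h.app i) ∈ distTriang S

/-- A map of Cauchy sequences is of type `n` if in any completion to a Cauchy sequence of
distinguished triangles, the third object lies in `M n` eventually. -/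
def IsTypeMap (M : ℕ → ObjectProperty S) (n : ℕ) {a b : ℕ ⥤ S} (f : a ⟶ b) : Prop :=
  ∀ (c : ℕ ⥤ S) (g : b ⟶ c) (h : c ⟶ a ⋙ shiftFunctor S (1 : ℤ)), IsCompletion M f g h →
    ∃ N : ℕ, ∀ i, N ≤ i → M n (c.obj i)

end Metric

section Modules

variable {S : Type u₁} [Category.{v} S] [Preadditive S]

variable (S) in
/-- `Mod-S`: the category of additive functors from `Sᵒᵖ` to abelian groups. -/
abbrev ModCat := Sᵒᵖ ⥤+ AddCommGrpCat.{v}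

variable (S) in
/-- The Yoneda embedding `Y : S ⥤ Mod-S`. -/
def Y : S ⥤ ModCat S :=
  ObjectProperty.lift _ preadditiveYoneda
    (fun X => inferInstanceAs (preadditiveYoneda.obj X).Additive)

/-- The constant sequence `X = X = X = ⋯`, with its colimit cocone `Y(X)`. -/
def constCocone (X : S) : Cocone ((Functor.const ℕ).obj X ⋙ Y S) where
  pt := (Y S).obj X
  ι := { app := fun _ => 𝟙 _ }

variable {T : Type u₂} [Category.{v} T] [Preadditive T]

/-- The restricted Yoneda functor `T ⥤ Mod-S`, sending `t` to `Hom(F(-), t)`. -/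
def restrictedYoneda (F : S ⥤ T) [F.Additive] : T ⥤ ModCat S :=
  ObjectProperty.lift _ (preadditiveYoneda ⋙ (Functor.whiskeringLeft _ _ _).obj F.op)
    (fun t => inferInstanceAs (F.op ⋙ preadditiveYoneda.obj t).Additive)

/-- The natural map `Y(s) = Hom(-, s) ⟶ Hom(F(-), F(s))`, given by `F`. -/
def yonedaComparison (F : S ⥤ T) [F.Additive] : Y S ⟶ F ⋙ restrictedYoneda F where
  app s := ObjectProperty.homMk (preadditiveYonedaMap F s)
  naturality s s' f := by
    ext X g
    exact F.map_comp g f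

end Modules

section Completion

variable {S : Type u₁} [Category.{v} S] [HasZeroObject S] [HasShift S ℤ] [Preadditive S]
  [∀ n : ℤ, (shiftFunctor S n).Additive] [Pretriangulated S]

/-- `L(S) ⊆ Mod-S`: the colimits `colim Y(a_*)` of Cauchy sequences. -/
def L (M : ℕ → ObjectProperty S) : ObjectProperty (ModCat S) := fun G =>
  ∃ (a : ℕ ⥤ S) (ι : a ⋙ Y S ⟶ (Functor.const ℕ).obj G),
    IsCauchy M a ∧ Nonempty (IsColimit (Cocone.mk G ι))

/-- `L_i ⊆ L(S)`: the colimits `colim Y(a_*)` of Cauchy sequences contained in `M i`. -/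
def LBall (M : ℕ → ObjectProperty S) (i : ℕ) : ObjectProperty (ModCat S) := fun G =>
  ∃ (a : ℕ ⥤ S) (ι : a ⋙ Y S ⟶ (Functor.const ℕ).obj G),
    IsCauchy M a ∧ (∀ k, M i (a.obj k)) ∧ Nonempty (IsColimit (Cocone.mk G ι))

/-- `C(S) ⊆ Mod-S`: the union over `i` of the `Y(M i)^⊥`. -/
def CompactlySupported (M : ℕ → ObjectProperty S) : ObjectProperty (ModCat S) := fun G =>
  ∃ i, ((M i).map (Y S)).rightOrthogonal G

/-- `𝔖(S) = L(S) ∩ C(S)`. -/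
def SComp (M : ℕ → ObjectProperty S) : ObjectProperty (ModCat S) :=
  L M ⊓ CompactlySupported M

/-- Let `A = colim Y(a_*)` and `B = colim Y(b_*)`. A morphism `φ : A ⟶ B` is of type `n` with
respect to `(a_*, b_*)` if there are subsequences of `a_*` and `b_*` and a type-`n` map `f`
between them with `φ = colim Y(f)`. -/
def IsTypeWrt (M : ℕ → ObjectProperty S) (n : ℕ) {a b : ℕ ⥤ S}
    (A : Cocone (a ⋙ Y S)) (B : Cocone (b ⋙ Y S)) (φ : A.pt ⟶ B.pt) : Prop :=
  ∃ (p q : ℕ → ℕ) (hp : StrictMono p) (hq : StrictMono q)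
    (f : hp.monotone.functor ⋙ a ⟶ hq.monotone.functor ⋙ b),
    (∀ i, A.ι.app (p i) ≫ φ = (Y S).map (f.app i) ≫ B.ι.app (q i)) ∧ IsTypeMap M n f

/-- An excellent metric: it satisfies the two conditions of a very good metric, and every `X`
admits a suitable type-`m` morphism `Y(X) ⟶ D` with respect to the constant sequence `X` and a
Cauchy sequence `d_*` with colimit `D`. -/
structure IsExcellentMetric (M : ℕ → ObjectProperty S) : Prop extends IsVeryGoodMetric M where
  coapprox : ∀ m : ℕ, ∃ n : ℕ, m < n ∧ ∀ X : S,
    ∃ (d : ℕ ⥤ S) (D : Cocone (d ⋙ Y S)) (φ : (Y S).obj X ⟶ D.pt),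
      IsCauchy M d ∧ Nonempty (IsColimit D) ∧ IsTypeWrt M m (constCocone X) D φ ∧
        SComp M D.pt ∧ (LBall M n).rightOrthogonal D.pt

end Completion

section Extension

variable {T : Type u₂} [Category.{v} T] [HasZeroObject T] [HasShift T ℤ] [Preadditive T]
  [∀ n : ℤ, (shiftFunctor T n).Additive] [Pretriangulated T]

/-- A homotopy colimit of a sequence `b`: a coproduct of the `b i`, together with a
distinguished triangle `∐ b i ⟶ ∐ b i ⟶ pt ⟶ Σ ∐ b i` on the map `1 - shift`. -/
structure Hocolim (b : ℕ ⥤ T) where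
  cofan : Cofan (fun i => b.obj i)
  isColimit : IsColimit cofan
  pt : T
  π : cofan.pt ⟶ pt
  δ : pt ⟶ cofan.pt⟦(1 : ℤ)⟧
  dist : Triangle.mk (Cofan.IsColimit.desc isColimit
    (fun i => cofan.inj i - b.map (homOfLE i.le_succ) ≫ cofan.inj (i + 1))) π δ ∈ distTriang T

/-- The cocone of natural maps `b i ⟶ hocolim b`. -/
def Hocolim.cocone {b : ℕ ⥤ T} (H : Hocolim b) : Cocone b where
  pt := H.pt
  ι := NatTrans.ofSequence (fun i => H.cofan.inj i ≫ H.π) (fun i => by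
    have h := comp_distTriang_mor_zero₁₂ _ H.dist
    have h' : H.cofan.inj i ≫ Cofan.IsColimit.desc H.isColimit
        (fun i => H.cofan.inj i - b.map (homOfLE i.le_succ) ≫ H.cofan.inj (i + 1)) ≫ H.π = 0 :=
      (H.cofan.inj i ≫= h).trans comp_zero
    have h'' := Cofan.IsColimit.fac H.isColimit
      (fun i => H.cofan.inj i - b.map (homOfLE i.le_succ) ≫ H.cofan.inj (i + 1)) i
    rw [← Category.assoc, h'', Preadditive.sub_comp, sub_eq_zero] at h'
    simpa using h'.symm)

variable {S : Type u₁} [Category.{v} S] [HasZeroObject S] [HasShift S ℤ] [Preadditive S]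
  [∀ n : ℤ, (shiftFunctor S n).Additive] [Pretriangulated S]

/-- The natural cocone `Y(a_*) ⟶ Hom(F(-), hocolim F(a_*))`. -/
def comparisonCocone (F : S ⥤ T) [F.Additive] {a : ℕ ⥤ S} (H : Hocolim (a ⋙ F)) :
    Cocone (a ⋙ Y S) :=
  (Cocone.precompose (Functor.whiskerLeft a (yonedaComparison F))).obj
    ((restrictedYoneda F).mapCocone H.cocone)

/-- A fully faithful triangulated functor `F` is a good extension with respect to the metric if,
for every Cauchy sequence `a_*`, the coproduct of the `F(a i)` exists in `T` and the natural map
`colim Y(a_*) ⟶ Hom(F(-), hocolim F(a_*))` is an isomorphism. -/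
structure IsGoodExtension (M : ℕ → ObjectProperty S) (F : S ⥤ T) [F.CommShift ℤ]
    [F.Additive] : Prop where
  full : F.Full
  faithful : F.Faithful
  triangulated : F.IsTriangulated
  hasCoproduct : ∀ a : ℕ ⥤ S, IsCauchy M a → HasCoproduct (fun i => F.obj (a.obj i))
  isColimit : ∀ a : ℕ ⥤ S, IsCauchy M a → ∀ H : Hocolim (a ⋙ F),
    Nonempty (IsColimit (comparisonCocone F H))

/-- `L'(S) ⊆ T`: the homotopy colimits of `F(a_*)`, with `a_*` Cauchy. -/
def LPrime (M : ℕ → ObjectProperty S) (F : S ⥤ T) : ObjectProperty T := fun X =>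
  ∃ a : ℕ ⥤ S, IsCauchy M a ∧ ∃ H : Hocolim (a ⋙ F), Nonempty (H.pt ≅ X)

/-- `L'_i ⊆ L'(S)`: the homotopy colimits of `F(a_*)`, with `a_*` Cauchy and contained in
`M i`. -/
def LPrimeBall (M : ℕ → ObjectProperty S) (F : S ⥤ T) (i : ℕ) : ObjectProperty T := fun X =>
  ∃ a : ℕ ⥤ S, IsCauchy M a ∧ (∀ k, M i (a.obj k)) ∧
    ∃ H : Hocolim (a ⋙ F), Nonempty (H.pt ≅ X)

/-- `𝔖(S)` viewed inside `L'(S)`: the objects of `L'(S)` whose image under the restricted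
Yoneda functor is in `C(S)`. -/
def SPrime (M : ℕ → ObjectProperty S) (F : S ⥤ T) [F.Additive] : ObjectProperty T :=
  LPrime M F ⊓ (CompactlySupported M).inverseImage (restrictedYoneda F)

end Extension

end MetricTriang

/-!
The idea is to measure everything by the test objects `q` in `⊥(M n)`. Since the metric is very
good and each `M m` is closed under direct summands, an object of `S` that receives no maps from
`⊥(M n)`, with `n` large with respect to `m`, lies in `M m` (`exists_mem_of_forall_eq_zero`). Hence
a sequence is Cauchy if and only if its transition maps eventually induce bijections on `Hom(q, -)`
for all `q` in `⊥(M n)` (`IsCauchy.exists_homBij`, `isCauchy_of_homBij`). Call `F s ⟶ X` an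
`n`-approximation if it induces bijections on `Hom(F q, -)` for all `q` in `⊥(M n)`. Good
extensions are such that the terms of a Cauchy sequence are arbitrarily good approximations of its
homotopy colimit (`IsGoodExtension.exists_isApprox`).

Conversely, `exists_hocolim_iso` recognizes homotopy colimits of Cauchy sequences: if `X` is
generated by `F S`, in the sense that `X` is in `⊥((F S)^⊥)`, and has arbitrarily good
approximations `F s ⟶ X` with `s` in `M m`, then `X` is in `L'_m`. The approximations can be
arranged in a Cauchy sequence because each `s` lies in some `⊥(M N)`, so that `F s ⟶ X` lifts
through any `N`-approximation. This avoids choosing cones functorially: the fibre of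
`F B ⟶ hocolim F(d_*)` need not be compared with a telescope of fibres of `B ⟶ d i`, it suffices
that each of those fibres approximates it, which is the five lemma (`IsApprox.exists_fiber`).

If the metric is excellent, let `C` be the homotopy colimit of the sequence `d_*` given for `B` and
`m + 1`. A completion of the type-`(m + 1)` map from `B` to `d_*` shows that the fibres of
`B ⟶ d i` are in `M m` for large `i`; they approximate the fibre of `F B ⟶ C`, which is therefore
in `L'_m`. Conversely, given a triangle `A ⟶ F B ⟶ C` with `A = hocolim F(a_*)` and
`C = hocolim F(d_*)`, the map `F B ⟶ C` factors through some `B ⟶ d i`. For large `i` and `j`, the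
fibre of `B ⟶ d i` and `a j` both approximate `A`, so they differ by an object of `M (m + 2)`
(`exists_cone_mem_of_triangle`), and `B ⟶ d_*` is of type `m`.
-/

set_option linter.unusedSectionVars false

namespace MetricTriang

/-! ### Morphisms seen as bijective by a test object -/

section HomBij

variable {C : Type u₁} [Category.{v} C]

/-- Composition with `f : X ⟶ Y` is a bijection `Hom(Q, X) ≃ Hom(Q, Y)`. -/
def HomBij (Q : C) {X Y : C} (f : X ⟶ Y) : Prop :=
  Function.Bijective (fun g : Q ⟶ X => g ≫ f)

variable {Q Q' X Y Z : C}

lemma HomBij.exists_eq {f : X ⟶ Y} (h : HomBij Q f) (g : Q ⟶ Y) : ∃ g' : Q ⟶ X, g' ≫ f = g :=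
  h.2 g

lemma HomBij.eq {f : X ⟶ Y} (h : HomBij Q f) {g g' : Q ⟶ X} (w : g ≫ f = g' ≫ f) : g = g' :=
  h.1 w

lemma HomBij.eq_zero [HasZeroMorphisms C] {f : X ⟶ Y} (h : HomBij Q f) {g : Q ⟶ X}
    (w : g ≫ f = 0) : g = 0 :=
  h.eq (w.trans zero_comp.symm)

lemma HomBij.of_isIso (Q : C) (f : X ⟶ Y) [IsIso f] : HomBij Q f :=
  ⟨fun _ _ w => (cancel_mono f).1 w, fun g => ⟨g ≫ inv f, by simp⟩⟩

lemma HomBij.comp {f : X ⟶ Y} {g : Y ⟶ Z} (hf : HomBij Q f) (hg : HomBij Q g) :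
    HomBij Q (f ≫ g) := by
  have := Function.Bijective.comp hg hf
  simpa [HomBij, Function.comp_def] using this

lemma HomBij.of_comp_right {f : X ⟶ Y} {g : Y ⟶ Z} (hg : HomBij Q g)
    (hfg : HomBij Q (f ≫ g)) : HomBij Q f := by
  refine (Function.Bijective.of_comp_iff' hg _).1 ?_
  simpa [HomBij, Function.comp_def] using hfg

lemma HomBij.of_comp_left {f : X ⟶ Y} {g : Y ⟶ Z} (hf : HomBij Q f)
    (hfg : HomBij Q (f ≫ g)) : HomBij Q g := by
  refine (Function.Bijective.of_comp_iff _ hf).1 ?_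
  simpa [HomBij, Function.comp_def] using hfg

lemma HomBij.of_iso (e : Q ≅ Q') {f : X ⟶ Y} (h : HomBij Q f) : HomBij Q' f := by
  refine ⟨fun g g' w => ?_, fun g => ?_⟩
  · have := h.eq (g := e.hom ≫ g) (g' := e.hom ≫ g') (by simpa using w)
    simpa using this
  · obtain ⟨g', hg'⟩ := h.exists_eq (e.hom ≫ g)
    exact ⟨e.inv ≫ g', by simp [hg']⟩

lemma HomBij.map_iff {D : Type u₂} [Category.{v} D] (F : C ⥤ D) [F.Full] [F.Faithful]
    {f : X ⟶ Y} : HomBij (F.obj Q) (F.map f) ↔ HomBij Q f := by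
  constructor
  · intro h
    refine ⟨fun g g' w => F.map_injective (h.eq ?_), fun g => ?_⟩
    · simpa using congrArg F.map w
    · obtain ⟨g', hg'⟩ := h.exists_eq (F.map g)
      obtain ⟨g'', rfl⟩ := F.map_surjective g'
      exact ⟨g'', F.map_injective (by simpa using hg')⟩
  · intro h
    refine ⟨fun g g' w => ?_, fun g => ?_⟩
    · obtain ⟨g, rfl⟩ := F.map_surjective g
      obtain ⟨g', rfl⟩ := F.map_surjective g'
      rw [h.eq (F.map_injective (by simpa using w) : g ≫ f = g' ≫ f)]
    · obtain ⟨g, rfl⟩ := F.map_surjective g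
      obtain ⟨g', hg'⟩ := h.exists_eq g
      exact ⟨F.map g', by simp [← hg']⟩

lemma HomBij.shift_iff [HasShift C ℤ] {f : X ⟶ Y} :
    HomBij (Q⟦(1 : ℤ)⟧) (f⟦(1 : ℤ)⟧') ↔ HomBij Q f :=
  HomBij.map_iff (shiftFunctor C (1 : ℤ))

lemma HomBij.of_injective_of_exists [Preadditive C] {f : X ⟶ Y}
    (h₀ : ∀ x : Q ⟶ X, x ≫ f = 0 → x = 0) (h₁ : ∀ y : Q ⟶ Y, ∃ x : Q ⟶ X, x ≫ f = y) :
    HomBij Q f := by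
  refine ⟨fun x y w => ?_, h₁⟩
  rw [← sub_eq_zero]
  exact h₀ _ (by rw [Preadditive.sub_comp, sub_eq_zero]; exact w)

variable [HasZeroObject C] [HasShift C ℤ] [Preadditive C]
  [∀ n : ℤ, (shiftFunctor C n).Additive] [Pretriangulated C]

lemma exists_hom₃ {X' Y' Z' : C} {f : X ⟶ Y} {g : Y ⟶ Z} {h : Z ⟶ X⟦(1 : ℤ)⟧}
    (hT : Triangle.mk f g h ∈ distTriang C) {f' : X' ⟶ Y'} {g' : Y' ⟶ Z'} {h' : Z' ⟶ X'⟦(1 : ℤ)⟧}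
    (hT' : Triangle.mk f' g' h' ∈ distTriang C) (a : X ⟶ X') (b : Y ⟶ Y') (w : f ≫ b = a ≫ f') :
    ∃ c : Z ⟶ Z', g ≫ c = b ≫ g' ∧ h ≫ a⟦(1 : ℤ)⟧' = c ≫ h' :=
  Pretriangulated.complete_distinguished_triangle_morphism _ _ hT hT' a b w

/-- The five lemma for `Hom(Q, -)` applied to a morphism of distinguished triangles. -/
lemma HomBij.hom₃ {T T' : Triangle C} (hT : T ∈ distTriang C) (hT' : T' ∈ distTriang C)
    (φ : T ⟶ T') (h₁ : HomBij Q φ.hom₁) (h₂ : HomBij Q φ.hom₂)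
    (h₁' : HomBij Q (φ.hom₁⟦(1 : ℤ)⟧')) (h₂' : HomBij Q (φ.hom₂⟦(1 : ℤ)⟧')) :
    HomBij Q φ.hom₃ := by
  refine .of_injective_of_exists (fun x hx => ?_) (fun x => ?_)
  · have h0 : x ≫ T.mor₃ = 0 := by
      refine h₁'.eq_zero ?_
      rw [Category.assoc, φ.comm₃, reassoc_of% hx, zero_comp]
    obtain ⟨y, rfl⟩ := T.coyoneda_exact₃ hT x h0
    obtain ⟨z, hz⟩ := T'.coyoneda_exact₂ hT' (y ≫ φ.hom₂) (by
      rw [Category.assoc, ← φ.comm₂, ← Category.assoc, hx])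
    obtain ⟨w, rfl⟩ := h₁.exists_eq z
    have : y = w ≫ T.mor₁ := h₂.eq (by rw [hz, Category.assoc, Category.assoc, φ.comm₁])
    rw [this, Category.assoc, comp_distTriang_mor_zero₁₂ _ hT, comp_zero]
  · obtain ⟨y, hy⟩ := h₁'.exists_eq (x ≫ T'.mor₃)
    obtain ⟨z, hz⟩ := T.coyoneda_exact₁ hT y (by
      refine h₂'.eq_zero ?_
      rw [Category.assoc, ← Functor.map_comp, φ.comm₁, Functor.map_comp, reassoc_of% hy,
        comp_distTriang_mor_zero₃₁ _ hT', comp_zero])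
    obtain ⟨w, hw⟩ := T'.coyoneda_exact₃ hT' (x - z ≫ φ.hom₃) (by
      rw [Preadditive.sub_comp, Category.assoc, ← φ.comm₃, ← Category.assoc, ← hz, hy, sub_self])
    obtain ⟨w', rfl⟩ := h₂.exists_eq w
    refine ⟨z + w' ≫ T.mor₂, ?_⟩
    rw [Preadditive.add_comp, Category.assoc, φ.comm₂, ← Category.assoc, ← hw]
    abel

end HomBij

/-! ### Orthogonals of a good metric -/

section Metric

variable {S : Type u₁} [Category.{v} S] [HasZeroObject S] [HasShift S ℤ] [Preadditive S]
  [∀ n : ℤ, (shiftFunctor S n).Additive] [Pretriangulated S] {M : ℕ → ObjectProperty S}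

lemma IsGoodMetric.of_le (hM : IsGoodMetric M) {i j : ℕ} (hij : i ≤ j) {X : S} (h : M j X) :
    M i X := by
  induction hij with
  | refl => exact h
  | step _ ih => exact ih (hM.anti _ _ h)

lemma IsGoodMetric.of_iso (hM : IsGoodMetric M) (i : ℕ) {X Y : S} (e : X ≅ Y) (h : M i X) :
    M i Y := by
  obtain ⟨Z, hZ, h'⟩ := (hM.zero i).exists_zero
  refine hM.ext i (Triangle.mk e.hom (0 : Y ⟶ Z) 0) ?_ h h'
  exact isomorphic_distinguished _ (contractible_distinguished X) _
    (Triangle.isoMk _ _ (Iso.refl _) e.symm (hZ.iso (isZero_zero S))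
      (e.hom_inv_id.trans (Category.comp_id _).symm)
      ((isZero_zero S).eq_of_tgt _ _) (hZ.eq_of_src _ _))

lemma leftOrthogonal_of_le (hM : IsGoodMetric M) {i j : ℕ} (hij : i ≤ j) {q : S}
    (hq : (M i).leftOrthogonal q) : (M j).leftOrthogonal q :=
  fun _ f hY => hq f (hM.of_le hij hY)

lemma leftOrthogonal_shift (hM : IsGoodMetric M) {i : ℕ} {q : S}
    (hq : (M i).leftOrthogonal q) : (M (i + 1)).leftOrthogonal (q⟦(1 : ℤ)⟧) := by
  intro Y f hY
  have := hq ((shiftFunctorCompIsoId S (1 : ℤ) (-1) (by simp)).inv.app q ≫ f⟦(-1 : ℤ)⟧')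
    (hM.shift_neg _ _ hY)
  apply (shiftFunctor S (-1 : ℤ)).map_injective
  simpa using this

lemma leftOrthogonal_shift_neg (hM : IsGoodMetric M) {i : ℕ} {q : S}
    (hq : (M i).leftOrthogonal q) : (M (i + 1)).leftOrthogonal (q⟦(-1 : ℤ)⟧) := by
  intro Y f hY
  have := hq ((shiftFunctorCompIsoId S (-1 : ℤ) 1 (by simp)).inv.app q ≫ f⟦(1 : ℤ)⟧')
    (hM.shift_pos _ _ hY)
  apply (shiftFunctor S (1 : ℤ)).map_injective
  simpa using this

/-- If `q⟦-1⟧` and `q` both see `t` as bijective, then `q` does not see the cone of `t`. -/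
lemma eq_zero_of_homBij {s s' p q : S} {t : s ⟶ s'} {g : s' ⟶ p} {h : p ⟶ s⟦(1 : ℤ)⟧}
    (hT : Triangle.mk t g h ∈ distTriang S) (h₀ : HomBij q t) (h₁ : HomBij (q⟦(-1 : ℤ)⟧) t)
    (f : q ⟶ p) : f = 0 := by
  have h₂ : HomBij q (t⟦(1 : ℤ)⟧') :=
    (HomBij.shift_iff.2 h₁).of_iso ((shiftFunctorCompIsoId S (-1 : ℤ) 1 (by simp)).app q)
  have h₃₁ : h ≫ t⟦(1 : ℤ)⟧' = 0 := comp_distTriang_mor_zero₃₁ _ hT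
  have h₁₂ : t ≫ g = 0 := comp_distTriang_mor_zero₁₂ _ hT
  have h₃ : f ≫ h = 0 := h₂.eq_zero (by rw [Category.assoc, h₃₁, comp_zero])
  obtain ⟨y, rfl⟩ := Triangle.coyoneda_exact₃ _ hT f h₃
  obtain ⟨z, rfl⟩ := h₀.exists_eq y
  exact (Category.assoc z t g).trans (by rw [h₁₂, comp_zero])

/-- A morphism whose cone is in `M (n + 1)` is seen as bijective by `⊥(M n)`. -/
lemma homBij_of_cone (hM : IsGoodMetric M) {n : ℕ} {s s' p q : S} {t : s ⟶ s'} {g : s' ⟶ p}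
    {h : p ⟶ s⟦(1 : ℤ)⟧} (hT : Triangle.mk t g h ∈ distTriang S) (hp : M (n + 1) p)
    (hq : (M n).leftOrthogonal q) : HomBij q t := by
  refine .of_injective_of_exists (fun x hx => ?_) (fun x => ?_)
  · obtain ⟨y, rfl⟩ := Triangle.coyoneda_exact₂ _ (inv_rot_of_distTriang _ hT) x hx
    have : y = 0 := hq y (hM.shift_neg _ _ hp)
    exact (congrArg (· ≫ _) this).trans zero_comp
  · obtain ⟨y, rfl⟩ := Triangle.coyoneda_exact₂ _ hT x (hq _ (hM.anti _ _ hp))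
    exact ⟨y, rfl⟩

/-- Membership in `M m` can be tested by maps from `⊥(M n)`, for `n` large: if `p` receives no
maps from `⊥(M n)`, then in the approximating triangle `E ⟶ p ⟶ D` the first map vanishes and
`p` is a direct summand of `D`. -/
lemma exists_mem_of_forall_eq_zero (hM : IsVeryGoodMetric M) (hsum : SummandClosed M) (m : ℕ) :
    ∃ n, ∀ p : S, (∀ q, (M n).leftOrthogonal q → ∀ f : q ⟶ p, f = 0) → M m p := by
  obtain ⟨n, -, hn⟩ := hM.approx m
  refine ⟨n, fun p hp => ?_⟩
  obtain ⟨E, D, f, g, h, hT, hE, hD⟩ := hn p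
  obtain ⟨e, -, -⟩ := exists_iso_binaryBiproduct_of_distTriang _ (rot_of_distTriang _ hT)
    (show -f⟦(1 : ℤ)⟧' = 0 by rw [hp E hE f, Functor.map_zero, neg_zero])
  exact hsum m _ _ (hM.of_iso m e hD)

/-- A morphism seen as bijective by `⊥(M n)`, for `n` large, has its cone in `M m`. -/
lemma exists_cone_mem (hM : IsVeryGoodMetric M) (hsum : SummandClosed M) (m : ℕ) :
    ∃ n, ∀ (s s' : S) (t : s ⟶ s'), (∀ q, (M n).leftOrthogonal q → HomBij q t) →
      ∀ (p : S) (g : s' ⟶ p) (h : p ⟶ s⟦(1 : ℤ)⟧), Triangle.mk t g h ∈ distTriang S → M m p := by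
  obtain ⟨n, hn⟩ := exists_mem_of_forall_eq_zero hM hsum m
  exact ⟨n + 1, fun s s' t ht p g h hT => hn p fun q hq f => eq_zero_of_homBij hT
    (ht q (leftOrthogonal_of_le hM.toIsGoodMetric n.le_succ hq))
    (ht _ (leftOrthogonal_shift_neg hM.toIsGoodMetric hq)) f⟩

lemma IsCauchy.exists_homBij (hM : IsGoodMetric M) {a : ℕ ⥤ S} (ha : IsCauchy M a) (n : ℕ) :
    ∃ N, ∀ (i j : ℕ) (hij : i ≤ j), N ≤ i → ∀ q, (M n).leftOrthogonal q →
      HomBij q (a.map (homOfLE hij)) := by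
  obtain ⟨N, hN⟩ := ha (n + 1)
  refine ⟨N, fun i j hij hi q hq => ?_⟩
  obtain rfl | hlt := hij.eq_or_lt
  · rw [show homOfLE hij = 𝟙 i from rfl, a.map_id]
    exact HomBij.of_isIso _ _
  · obtain ⟨Z, g, h, hT⟩ := distinguished_cocone_triangle (a.map (homOfLE hij))
    exact homBij_of_cone hM hT (hN i j hlt hi Z g h hT) hq

/-- A sequence whose transition maps are eventually seen as bijective by each `⊥(M n)` is
Cauchy. -/
lemma isCauchy_of_homBij (hM : IsVeryGoodMetric M) (hsum : SummandClosed M) {a : ℕ ⥤ S}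
    (h : ∀ n, ∃ N, ∀ (i j : ℕ) (hij : i ≤ j), N ≤ i → ∀ q, (M n).leftOrthogonal q →
      HomBij q (a.map (homOfLE hij))) : IsCauchy M a := by
  intro m
  obtain ⟨n, hn⟩ := exists_cone_mem hM hsum m
  obtain ⟨N, hN⟩ := h n
  exact ⟨N, fun i j hij hi D g k hT => hn _ _ _ (hN i j hij.le hi) D g k hT⟩

lemma isCauchy_const (hM : IsGoodMetric M) (X : S) : IsCauchy M ((Functor.const ℕ).obj X) := by
  intro n
  refine ⟨0, fun i j _ _ D g h hT => ?_⟩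
  have : IsZero D := Triangle.isZero₃_of_isIso₁ _ hT (inferInstanceAs (IsIso (𝟙 X)))
  obtain ⟨Z, hZ, h'⟩ := (hM.zero n).exists_zero
  exact hM.of_iso n (hZ.iso this) h'

lemma IsCauchy.comp {a : ℕ ⥤ S} (ha : IsCauchy M a) {q : ℕ → ℕ} (hq : StrictMono q) :
    IsCauchy M (hq.monotone.functor ⋙ a) := by
  intro n
  obtain ⟨N, hN⟩ := ha n
  exact ⟨N, fun i j hij hi D g h hT =>
    hN (q i) (q j) (hq hij) (hi.trans (hq.id_le i)) D g h hT⟩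

/-- A map from a constant sequence to a Cauchy sequence has a completion to a Cauchy sequence of
distinguished triangles. -/
lemma exists_isCompletion (hM : IsVeryGoodMetric M) (hsum : SummandClosed M) {X : S} {d : ℕ ⥤ S}
    (hd : IsCauchy M d) (f : (Functor.const ℕ).obj X ⟶ d) :
    ∃ (c : ℕ ⥤ S) (g : d ⟶ c) (h : c ⟶ (Functor.const ℕ).obj X ⋙ shiftFunctor S (1 : ℤ)),
      IsCompletion M f g h := by
  choose Z g h hT using fun i => distinguished_cocone_triangle (f.app i)
  have hf : ∀ (i j : ℕ) (hij : i ≤ j), f.app i ≫ d.map (homOfLE hij) = f.app j :=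
    fun i j hij => (f.naturality (homOfLE hij)).symm.trans (Category.id_comp _)
  have ht : ∀ i, ∃ t : Z i ⟶ Z (i + 1), g i ≫ t = d.map (homOfLE i.le_succ) ≫ g (i + 1) ∧
      h i = t ≫ h (i + 1) := by
    intro i
    obtain ⟨t, ht₁, ht₂⟩ := exists_hom₃ (hT i) (hT (i + 1)) (𝟙 X) (d.map (homOfLE i.le_succ))
      ((hf i _ i.le_succ).trans (Category.id_comp _).symm)
    exact ⟨t, ht₁, ((congrArg (h i ≫ ·) (CategoryTheory.Functor.map_id _ X)).trans
      (Category.comp_id _)).symm.trans ht₂⟩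
  choose t ht₁ ht₂ using ht
  let c : ℕ ⥤ S := Functor.ofSequence t
  have hc : ∀ i, c.map (homOfLE i.le_succ) = t i := Functor.ofSequence_map_homOfLE_succ t
  let g' : d ⟶ c := NatTrans.ofSequence g (fun i => by rw [hc]; exact (ht₁ i).symm)
  let h' : c ⟶ (Functor.const ℕ).obj X ⋙ shiftFunctor S (1 : ℤ) := NatTrans.ofSequence h
    (fun i => by
      rw [hc]
      exact (ht₂ i).symm.trans ((congrArg (h i ≫ ·) (CategoryTheory.Functor.map_id _ X)).trans
        (Category.comp_id _)).symm)
  refine ⟨c, g', h', isCauchy_of_homBij hM hsum fun n => ?_, hT⟩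
  obtain ⟨N, hN⟩ := hd.exists_homBij hM.toIsGoodMetric (n + 1)
  refine ⟨N, fun i j hij hi q hq => ?_⟩
  let φ : Triangle.mk (f.app i) (g i) (h i) ⟶ Triangle.mk (f.app j) (g j) (h j) :=
    { hom₁ := 𝟙 X
      hom₂ := d.map (homOfLE hij)
      hom₃ := c.map (homOfLE hij)
      comm₁ := (hf i j hij).trans (Category.id_comp _).symm
      comm₂ := (g'.naturality (homOfLE hij)).symm
      comm₃ := (h'.naturality (homOfLE hij)).symm }
  have h₂ := hN i j hij hi
  refine HomBij.hom₃ (hT i) (hT j) φ (HomBij.of_isIso _ (𝟙 X))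
    (h₂ q (leftOrthogonal_of_le hM.toIsGoodMetric n.le_succ hq)) ?_ ?_
  · exact HomBij.of_isIso _ ((𝟙 X)⟦(1 : ℤ)⟧')
  · exact (HomBij.shift_iff.2 (h₂ _ (leftOrthogonal_shift_neg hM.toIsGoodMetric hq))).of_iso
      ((shiftFunctorCompIsoId S (-1 : ℤ) 1 (by simp)).app q)

end Metric

/-! ### Colimits of additive functors are computed objectwise -/

section Modules

instance additiveFunctor_isClosedUnderColimitsOfShape {C : Type u₁} [Category.{v} C] [Preadditive C]
    (J : Type) [SmallCategory J] :
    (additiveFunctor C AddCommGrpCat.{v}).IsClosedUnderColimitsOfShape J where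
  colimitsOfShape_le := by
    rintro G ⟨h⟩
    refine ⟨fun {X Y f g} => ?_⟩
    have hX := isColimitOfPreserves ((evaluation C AddCommGrpCat.{v}).obj X) h.isColimit
    refine hX.hom_ext fun j => ?_
    have : (h.diag.obj j).Additive := h.prop_diag_obj j
    have key : ∀ k : X ⟶ Y, (h.ι.app j).app X ≫ G.map k =
        (h.diag.obj j).map k ≫ (h.ι.app j).app Y := fun k => ((h.ι.app j).naturality k).symm
    change (h.ι.app j).app X ≫ G.map (f + g) = (h.ι.app j).app X ≫ (G.map f + G.map g)
    rw [Preadditive.comp_add, key, key, key, Functor.map_add (h.diag.obj j), Preadditive.add_comp]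

variable {S : Type u₁} [Category.{v} S] [Preadditive S]

instance : PreservesColimitsOfShape ℕ (forget AddCommGrpCat.{v}) :=
  have := preservesFilteredColimitsOfSize_shrink.{0, v, 0, v} (forget AddCommGrpCat.{v})
  PreservesFilteredColimitsOfSize.preserves_filtered_colimits ℕ

/-- Evaluation of an additive functor at an object of `S`. -/
abbrev evalAt (q : S) : ModCat S ⥤ AddCommGrpCat.{v} :=
  AdditiveFunctor.forget _ _ ⋙ (evaluation _ _).obj (op q)

variable {T : Type u₂} [Category.{v} T] [HasZeroObject T] [HasShift T ℤ] [Preadditive T]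
  [∀ n : ℤ, (shiftFunctor T n).Additive] [Pretriangulated T]
  {F : S ⥤ T} [F.Additive] {a : ℕ ⥤ S} {H : Hocolim (a ⋙ F)}

lemma exists_lift_of_isColimit (hH : IsColimit (comparisonCocone F H)) {q : S}
    (x : F.obj q ⟶ H.pt) :
    ∃ (i : ℕ) (y : q ⟶ a.obj i), F.map y ≫ H.cocone.ι.app i = x :=
  let ⟨i, y, hy⟩ := Concrete.isColimit_exists_rep ((a ⋙ Y S) ⋙ evalAt q)
    (isColimitOfPreserves (evalAt q) hH)
    (show ToType (((evalAt q).mapCocone (comparisonCocone F H)).pt) from x)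
  ⟨i, y, hy⟩

lemma exists_map_eq_of_isColimit (hH : IsColimit (comparisonCocone F H)) {q : S} {i : ℕ}
    {x y : q ⟶ a.obj i} (h : F.map x ≫ H.cocone.ι.app i = F.map y ≫ H.cocone.ι.app i) :
    ∃ (j : ℕ) (hij : i ≤ j), x ≫ a.map (homOfLE hij) = y ≫ a.map (homOfLE hij) := by
  obtain ⟨j, f, g, hfg⟩ := Concrete.isColimit_exists_of_rep_eq _
    (isColimitOfPreserves (evalAt q) hH) (i := i) (j := i) x y h
  obtain rfl : f = g := Subsingleton.elim _ _
  exact ⟨j, leOfHom f, hfg⟩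

end Modules

/-! ### Homotopy colimits -/

lemma forall_hom_shift_eq_zero_iff {T : Type u₂} [Category.{v} T] [Preadditive T] [HasShift T ℤ]
    {X W : T} (n : ℤ) :
    (∀ f : X⟦n⟧ ⟶ W, f = 0) ↔ ∀ f : X ⟶ W⟦-n⟧, f = 0 := by
  rw [← subsingleton_iff_forall_eq, ← subsingleton_iff_forall_eq]
  exact ((shiftEquiv T n).toAdjunction.homEquiv X W).subsingleton_congr

section Hocolim

variable {T : Type u₂} [Category.{v} T] [HasZeroObject T] [HasShift T ℤ] [Preadditive T]
  [∀ n : ℤ, (shiftFunctor T n).Additive] [Pretriangulated T] {b : ℕ ⥤ T}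

lemma Hocolim.exists_desc (H : Hocolim b) (c : Cocone b) :
    ∃ θ : H.pt ⟶ c.pt, ∀ i, H.cocone.ι.app i ≫ θ = c.ι.app i := by
  obtain ⟨θ, hθ⟩ := Triangle.yoneda_exact₂ _ H.dist
    (Cofan.IsColimit.desc H.isColimit fun i => c.ι.app i) (by
      refine Cofan.IsColimit.hom_ext H.isColimit _ _ fun i => ?_
      change H.cofan.inj i ≫ Cofan.IsColimit.desc H.isColimit
        (fun i => H.cofan.inj i - b.map (homOfLE i.le_succ) ≫ H.cofan.inj (i + 1)) ≫
        Cofan.IsColimit.desc H.isColimit (fun i => c.ι.app i) = H.cofan.inj i ≫ 0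
      rw [← Category.assoc, Cofan.IsColimit.fac, Preadditive.sub_comp, Category.assoc,
        Cofan.IsColimit.fac, Cofan.IsColimit.fac, c.w, sub_self, comp_zero])
  refine ⟨θ, fun i => ?_⟩
  have h : Cofan.IsColimit.desc H.isColimit (fun i => c.ι.app i) = H.π ≫ θ := hθ
  have h' := Cofan.IsColimit.fac H.isColimit (fun i => c.ι.app i) i
  rw [h] at h'
  exact (Category.assoc _ _ _).trans h'

lemma Hocolim.map_comp_ι {S : Type u₁} [Category.{v} S] {F : S ⥤ T} {a : ℕ ⥤ S}
    (H : Hocolim (a ⋙ F)) {q : S} {i j : ℕ} (x : q ⟶ a.obj i) (hij : i ≤ j) :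
    F.map (x ≫ a.map (homOfLE hij)) ≫ H.cocone.ι.app j = F.map x ≫ H.cocone.ι.app i := by
  rw [F.map_comp, Category.assoc]
  exact congrArg (F.map x ≫ ·) (H.cocone.w (homOfLE hij))

lemma Hocolim.hom_eq_zero (H : Hocolim b) {W : T} (h₀ : ∀ i (f : b.obj i ⟶ W), f = 0)
    (h₁ : ∀ i (f : (b.obj i)⟦(1 : ℤ)⟧ ⟶ W), f = 0) (f : H.pt ⟶ W) : f = 0 := by
  obtain ⟨g, rfl⟩ := Triangle.yoneda_exact₃ _ H.dist f
    (Cofan.IsColimit.hom_ext H.isColimit _ _ fun i => (h₀ i _).trans (h₀ i _).symm)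
  have hg : g = 0 := (forall_hom_shift_eq_zero_iff 1).2 (fun k =>
    Cofan.IsColimit.hom_ext H.isColimit _ _ fun i =>
      ((forall_hom_shift_eq_zero_iff 1).1 (h₁ i) _).trans comp_zero.symm) g
  exact (congrArg (_ ≫ ·) hg).trans comp_zero

end Hocolim

/-! ### Generated objects and approximations -/

section Definitions

variable {S : Type u₁} [Category.{v} S] [Preadditive S] {T : Type u₂} [Category.{v} T]
  [Preadditive T] (M : ℕ → ObjectProperty S) (F : S ⥤ T)

/-- `X` lies in `⊥((F S)^⊥)`. This class contains the `F s` and is closed under the homotopy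
colimits and cones that exist in `T`; on it, `Hom(F(-), -)` detects isomorphisms. -/
def IsGenerated (X : T) : Prop :=
  ∀ ⦃W : T⦄, (∀ (s : S) (f : F.obj s ⟶ W), f = 0) → ∀ f : X ⟶ W, f = 0

/-- `u : F s ⟶ X` is an `n`-approximation if `⊥(M n)` sees it as bijective. Up to a change of `n`,
this says that the cone of `u` receives no maps from `F(⊥(M n))`. -/
def IsApprox (n : ℕ) {s : S} {X : T} (u : F.obj s ⟶ X) : Prop :=
  ∀ q, (M n).leftOrthogonal q → HomBij (F.obj q) u

variable {M F}

lemma isGenerated_obj (s : S) : IsGenerated F (F.obj s) := fun _ hW f => hW s f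

lemma eq_zero_of_shift [HasShift S ℤ] [HasShift T ℤ] [F.CommShift ℤ] {W : T}
    (hW : ∀ (s : S) (f : F.obj s ⟶ W), f = 0) (n : ℤ) (s : S) (f : (F.obj s)⟦n⟧ ⟶ W) :
    f = 0 := by
  rw [← cancel_epi ((F.commShiftIso n).hom.app s), comp_zero]
  exact hW (s⟦n⟧) _

lemma IsGenerated.shift [HasShift S ℤ] [HasShift T ℤ] [F.CommShift ℤ] {X : T}
    (hX : IsGenerated F X) (n : ℤ) : IsGenerated F (X⟦n⟧) := fun _ hW =>
  (forall_hom_shift_eq_zero_iff n).2 (hX fun s =>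
    (forall_hom_shift_eq_zero_iff n).1 (eq_zero_of_shift hW n s))

lemma IsApprox.comp_iso {n : ℕ} {s : S} {X X' : T} {u : F.obj s ⟶ X} (hu : IsApprox M F n u)
    (e : X ≅ X') : IsApprox M F n (u ≫ e.hom) :=
  fun q hq => (hu q hq).comp (HomBij.of_isIso _ _)

lemma IsApprox.of_le [HasZeroObject S] [HasShift S ℤ] [∀ n : ℤ, (shiftFunctor S n).Additive]
    [Pretriangulated S] (hM : IsGoodMetric M) {m n : ℕ} (hmn : m ≤ n) {s : S} {X : T}
    {u : F.obj s ⟶ X} (hu : IsApprox M F n u) : IsApprox M F m u :=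
  fun q hq => hu q (leftOrthogonal_of_le hM hmn hq)

end Definitions

section Extension

variable {S : Type u₁} [Category.{v} S] [HasZeroObject S] [HasShift S ℤ] [Preadditive S]
  [∀ n : ℤ, (shiftFunctor S n).Additive] [Pretriangulated S]
  {T : Type u₂} [Category.{v} T] [HasZeroObject T] [HasShift T ℤ] [Preadditive T]
  [∀ n : ℤ, (shiftFunctor T n).Additive] [Pretriangulated T]
  {M : ℕ → ObjectProperty S} {F : S ⥤ T} [F.CommShift ℤ] [F.Additive]

lemma IsGoodExtension.nonempty_hocolim (hF : IsGoodExtension M F) {a : ℕ ⥤ S}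
    (ha : IsCauchy M a) : Nonempty (Hocolim (a ⋙ F)) := by
  have : HasCoproduct (fun i => (a ⋙ F).obj i) := hF.hasCoproduct a ha
  obtain ⟨Z, g, h, hT⟩ := distinguished_cocone_triangle
    (Cofan.IsColimit.desc (coproductIsCoproduct (fun i => (a ⋙ F).obj i))
      (fun i => Cofan.inj (Cofan.mk _ (Sigma.ι (fun i => (a ⋙ F).obj i))) i -
        (a ⋙ F).map (homOfLE i.le_succ) ≫
          Cofan.inj (Cofan.mk _ (Sigma.ι (fun i => (a ⋙ F).obj i))) (i + 1)))
  exact ⟨⟨_, _, Z, g, h, hT⟩⟩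


lemma isGenerated_hocolim {a : ℕ ⥤ S} (H : Hocolim (a ⋙ F)) : IsGenerated F H.pt :=
  fun _ hW f => H.hom_eq_zero (fun i => hW (a.obj i))
    (fun i => eq_zero_of_shift hW 1 (a.obj i)) f

lemma IsGenerated.of_distTriang₁ {A B C : T} {α : A ⟶ B} {φ : B ⟶ C} {γ : C ⟶ A⟦(1 : ℤ)⟧}
    (hT : Triangle.mk α φ γ ∈ distTriang T) (hB : IsGenerated F B) (hC : IsGenerated F C) :
    IsGenerated F A := by
  intro W hW f
  obtain ⟨g, rfl⟩ := Triangle.yoneda_exact₂ _ (inv_rot_of_distTriang _ hT) f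
    (hC.shift (-1) hW _)
  exact (congrArg (α ≫ ·) (hB hW g)).trans comp_zero

/-- The functor `Hom(F(-), -)` detects isomorphisms between generated objects, because the cone of
a morphism it inverts is generated and right orthogonal to `F S`, hence zero. -/
lemma IsGenerated.isIso_of_homBij {X X' : T} (hX : IsGenerated F X) (hX' : IsGenerated F X')
    (θ : X ⟶ X') (h : ∀ q : S, HomBij (F.obj q) θ) : IsIso θ := by
  obtain ⟨W, g, k, hT⟩ := distinguished_cocone_triangle θ
  have h₁₂ : θ ≫ g = 0 := comp_distTriang_mor_zero₁₂ _ hT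
  have h₃₁ : k ≫ θ⟦(1 : ℤ)⟧' = 0 := comp_distTriang_mor_zero₃₁ _ hT
  have hW : ∀ (s : S) (f : F.obj s ⟶ W), f = 0 := by
    intro s f
    have h' : HomBij (F.obj s) (θ⟦(1 : ℤ)⟧') :=
      (HomBij.shift_iff.2 (h (s⟦(-1 : ℤ)⟧))).of_iso
        ((F.commShiftIso (1 : ℤ)).symm.app (s⟦(-1 : ℤ)⟧) ≪≫
          F.mapIso ((shiftFunctorCompIsoId S (-1 : ℤ) 1 (by simp)).app s))
    have h₃ : f ≫ k = 0 := h'.eq_zero (by rw [Category.assoc, h₃₁, comp_zero])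
    obtain ⟨y, rfl⟩ := Triangle.coyoneda_exact₃ _ hT f h₃
    obtain ⟨z, rfl⟩ := (h s).exists_eq y
    exact (Category.assoc z θ g).trans (by rw [h₁₂, comp_zero])
  refine (Triangle.isZero₃_iff_isIso₁ _ hT).1 ((IsZero.iff_id_eq_zero _).2 ?_)
  obtain ⟨e, he⟩ := Triangle.yoneda_exact₃ _ hT (𝟙 W) (hX' hW _)
  exact he.trans ((congrArg (k ≫ ·) (hX.shift 1 hW e)).trans comp_zero)


/-! ### Approximations of homotopy colimits -/

/-- The terms of a Cauchy sequence approximate its homotopy colimit: for `q` in `⊥(M n)` the groups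
`Hom(q, a i)` are eventually constant, and their colimit is `Hom(F q, hocolim F(a_*))` because the
extension is good. -/
lemma IsGoodExtension.exists_isApprox (hM : IsGoodMetric M) (hF : IsGoodExtension M F)
    {a : ℕ ⥤ S} (ha : IsCauchy M a) (H : Hocolim (a ⋙ F)) (n : ℕ) :
    ∃ N, ∀ i, N ≤ i → IsApprox M F n (s := a.obj i) (H.cocone.ι.app i) := by
  have := hF.full
  have := hF.faithful
  obtain ⟨hH⟩ := hF.isColimit a ha H
  obtain ⟨N, hN⟩ := ha.exists_homBij hM n
  refine ⟨N, fun i hi q hq => ⟨fun x y w => ?_, fun x => ?_⟩⟩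
  · obtain ⟨x, rfl⟩ := F.map_surjective x
    obtain ⟨y, rfl⟩ := F.map_surjective y
    obtain ⟨j, hij, hxy⟩ := exists_map_eq_of_isColimit hH w
    rw [(hN i j hij hi q hq).eq hxy]
  · obtain ⟨j, y, rfl⟩ := exists_lift_of_isColimit hH x
    obtain ⟨z, hz⟩ := (hN i (max i j) (le_max_left i j) hi q hq).exists_eq
      (y ≫ a.map (homOfLE (le_max_right i j)))
    refine ⟨F.map z, ?_⟩
    dsimp only
    rw [← H.cocone.w (homOfLE (le_max_left i j)), ← H.cocone.w (homOfLE (le_max_right i j))]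
    dsimp only [Functor.comp_map]
    rw [← Category.assoc, ← Category.assoc, ← F.map_comp, ← F.map_comp, hz]

/-- If `F d ⟶ C` approximates `C` and `F B ⟶ C` factors through it, then the fibre of `B ⟶ d`
approximates the fibre of `F B ⟶ C`, by the five lemma. -/
lemma IsApprox.exists_fiber (hM : IsGoodMetric M) (hF : IsGoodExtension M F)
    {n : ℕ} {A C : T} {B d k : S} {α : A ⟶ F.obj B} {φ : F.obj B ⟶ C} {γ : C ⟶ A⟦(1 : ℤ)⟧}
    (hT : Triangle.mk α φ γ ∈ distTriang T) {κ : k ⟶ B} {b : B ⟶ d} {δ : d ⟶ k⟦(1 : ℤ)⟧}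
    (hS : Triangle.mk κ b δ ∈ distTriang S) {u : F.obj d ⟶ C} (hu : IsApprox M F (n + 1) u)
    (w : F.map b ≫ u = φ) : ∃ u' : F.obj k ⟶ A, IsApprox M F n u' := by
  have := hF.triangulated
  have hFS := F.map_distinguished _ hS
  obtain ⟨u', h₁, h₃⟩ := complete_distinguished_triangle_morphism₁ _ _ hFS hT
    (𝟙 (F.obj B)) u (w.trans (Category.id_comp _).symm)
  let ψ : F.mapTriangle.obj (Triangle.mk κ b δ) ⟶ Triangle.mk α φ γ :=
    { hom₁ := u'
      hom₂ := 𝟙 (F.obj B)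
      hom₃ := u
      comm₁ := h₁
      comm₂ := w.trans (Category.id_comp _).symm
      comm₃ := h₃ }
  refine ⟨u', fun q hq => HomBij.shift_iff.1 ?_⟩
  have hu₁ := hu q (leftOrthogonal_of_le hM n.le_succ hq)
  have hu₂ : HomBij ((F.obj q)⟦(1 : ℤ)⟧) u :=
    (hu _ (leftOrthogonal_shift hM hq)).of_iso ((F.commShiftIso (1 : ℤ)).app q)
  exact HomBij.hom₃ (rot_of_distTriang _ hFS) (rot_of_distTriang _ hT) ((rotate T).map ψ)
    (HomBij.of_isIso _ (𝟙 (F.obj B))) hu₂ (HomBij.of_isIso _ ((𝟙 (F.obj B))⟦(1 : ℤ)⟧'))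
    (HomBij.shift_iff.2 hu₁)

/-- Recognition of homotopy colimits of Cauchy sequences: a generated object `X` that has
`n`-approximations for all `n`, with source in `P`, is the homotopy colimit of a Cauchy sequence in
`P`. Since every object of `S` lies in some `⊥(M N)`, each approximation factors through all
sufficiently fine ones, which gives the transition maps. -/
lemma exists_hocolim_iso (hM : IsVeryGoodMetric M) (hsum : SummandClosed M)
    (hF : IsGoodExtension M F) (P : ObjectProperty S) {X : T} (hX : IsGenerated F X)
    (h : ∀ n, ∃ (s : S) (u : F.obj s ⟶ X), P s ∧ IsApprox M F n u) :
    ∃ a : ℕ ⥤ S, IsCauchy M a ∧ (∀ k, P (a.obj k)) ∧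
      ∃ H : Hocolim (a ⋙ F), Nonempty (H.pt ≅ X) := by
  have := hF.full
  have := hF.faithful
  choose s u hP hu using h
  choose N hN using fun n => hM.exhaust (s n)
  -- The indices `r i` are chosen so that `s (r i)` lies in `⊥(M (r (i + 1)))`.
  let r : ℕ → ℕ := fun i => Nat.rec 0 (fun _ k => max (N k) (k + 1)) i
  have hr : StrictMono r := strictMono_nat_of_lt_succ fun i => le_max_right (N (r i)) (r i + 1)
  have ht : ∀ i, ∃ t : s (r i) ⟶ s (r (i + 1)), F.map t ≫ u (r (i + 1)) = u (r i) := by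
    intro i
    obtain ⟨g, hg⟩ := (hu (r (i + 1)) (s (r i)) (leftOrthogonal_of_le hM.toIsGoodMetric
      (le_max_left (N (r i)) (r i + 1)) (hN (r i)))).exists_eq (u (r i))
    obtain ⟨t, rfl⟩ := F.map_surjective g
    exact ⟨t, hg⟩
  choose t ht using ht
  let a : ℕ ⥤ S := Functor.ofSequence t
  have ha : ∀ i, a.map (homOfLE i.le_succ) = t i := Functor.ofSequence_map_homOfLE_succ t
  let c : Cocone (a ⋙ F) :=
    { pt := X
      ι := NatTrans.ofSequence (fun i => u (r i)) (fun i =>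
        ((congrArg (fun x => F.map x ≫ u (r (i + 1))) (ha i)).trans (ht i)).trans
          (Category.comp_id _).symm) }
  have hu' : ∀ n i, n ≤ i → IsApprox M F n (u (r i)) := fun n i hi =>
    (hu (r i)).of_le hM.toIsGoodMetric (hi.trans (hr.id_le i))
  have hac : IsCauchy M a := isCauchy_of_homBij hM hsum fun n => ⟨n, fun i j hij hi q hq => by
    have h₁ : HomBij (F.obj q) (c.ι.app i) := hu' n i hi q hq
    have h₂ : HomBij (F.obj q) (c.ι.app j) := hu' n j (hi.trans hij) q hq
    rw [← c.w (homOfLE hij)] at h₁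
    exact (HomBij.map_iff F).1 (h₂.of_comp_right h₁)⟩
  obtain ⟨H⟩ := hF.nonempty_hocolim hac
  obtain ⟨θ, hθ⟩ := H.exists_desc c
  have : IsIso θ := (isGenerated_hocolim H).isIso_of_homBij hX θ fun q => by
    obtain ⟨n, hq⟩ := hM.exhaust q
    obtain ⟨K, hK⟩ := hF.exists_isApprox hM.toIsGoodMetric hac H n
    have h : HomBij (F.obj q) (c.ι.app (max n K)) := hu' n _ (le_max_left _ _) q hq
    rw [← hθ] at h
    exact (hK (max n K) (le_max_right _ _) q hq).of_comp_left h
  exact ⟨a, hac, fun k => hP _, H, ⟨asIso θ⟩⟩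

lemma lPrime_obj (hM : IsVeryGoodMetric M) (hsum : SummandClosed M) (hF : IsGoodExtension M F)
    (s : S) : LPrime M F (F.obj s) := by
  obtain ⟨a, ha, -, h⟩ := exists_hocolim_iso hM hsum hF ⊤ (isGenerated_obj s)
    (fun _ => ⟨s, 𝟙 _, trivial, fun _ _ => HomBij.of_isIso _ _⟩)
  exact ⟨a, ha, h⟩

lemma lPrimeBall_obj (hM : IsVeryGoodMetric M) (hsum : SummandClosed M)
    (hF : IsGoodExtension M F) {n : ℕ} {s : S} (hs : M n s) : LPrimeBall M F n (F.obj s) :=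
  exists_hocolim_iso hM hsum hF (M n) (isGenerated_obj s)
    (fun _ => ⟨s, 𝟙 _, hs, fun _ _ => HomBij.of_isIso _ _⟩)

end Extension

/-! ### The restricted Yoneda functor -/

section Yoneda

variable {S : Type u₁} [Category.{v} S] [Preadditive S] {T : Type u₂} [Category.{v} T]
  [Preadditive T] {F : S ⥤ T} [F.Additive]

/-- A form of the Yoneda lemma: natural transformations `Y x ⟶ Hom(F(-), Z)` correspond to morphisms
`F x ⟶ Z`. -/
lemma forall_yoneda_hom_eq_zero_iff (x : S) (Z : T) :
    (∀ ψ : (Y S).obj x ⟶ (restrictedYoneda F).obj Z, ψ = 0) ↔ ∀ y : F.obj x ⟶ Z, y = 0 := by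
  let one : ToType (((Y S).obj x).obj.obj (op x)) := 𝟙 x
  constructor
  · intro h y
    have h' : F.map (𝟙 x) ≫ y = 0 :=
      congrArg (fun ψ : (Y S).obj x ⟶ (restrictedYoneda F).obj Z => ψ.hom.app (op x) one)
        (h ((yonedaComparison F).app x ≫ (restrictedYoneda F).map y))
    rwa [F.map_id, Category.id_comp] at h'
  · intro h ψ
    refine ObjectProperty.hom_ext _ (NatTrans.ext (funext fun q => AddCommGrpCat.ext fun g => ?_))
    let g' : q.unop ⟶ x := g
    have h' := ConcreteCategory.congr_hom (ψ.hom.naturality g'.op) one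
    have hg : ((Y S).obj x).obj.map g'.op one = g := Category.comp_id g'
    have h₀ : ψ.hom.app (op x) one = 0 := h _
    rw [ConcreteCategory.comp_apply, ConcreteCategory.comp_apply, hg, h₀, map_zero] at h'
    exact h'

lemma map_comp_yonedaComparison {x x' : S} (b : x ⟶ x') {Z : T} (y : F.obj x' ⟶ Z) :
    (Y S).map b ≫ (yonedaComparison F).app x' ≫ (restrictedYoneda F).map y =
      (yonedaComparison F).app x ≫ (restrictedYoneda F).map (F.map b ≫ y) := by
  rw [Functor.map_comp, ← Category.assoc, (yonedaComparison F).naturality b, Category.assoc]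
  rfl

/-- `Y x` is the colimit of the constant sequence `x`. -/
def isColimitConstCocone (x : S) : IsColimit (constCocone x) where
  desc s := s.ι.app 0
  fac s i := by
    rw [← s.w (homOfLE (Nat.zero_le i))]
    change 𝟙 _ ≫ (Y S).map (𝟙 x) ≫ s.ι.app i = s.ι.app i
    rw [CategoryTheory.Functor.map_id]
    exact (Category.id_comp _).trans (Category.id_comp _)
  uniq s m hm := by
    rw [← hm 0]
    exact (Category.id_comp m).symm

end Yoneda

/-! ### Excellent metrics and approximating triangles in `T` -/

section Main

variable {S : Type u₁} [Category.{v} S] [HasZeroObject S] [HasShift S ℤ] [Preadditive S]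
  [∀ n : ℤ, (shiftFunctor S n).Additive] [Pretriangulated S]
  {T : Type u₂} [Category.{v} T] [HasZeroObject T] [HasShift T ℤ] [Preadditive T]
  [∀ n : ℤ, (shiftFunctor T n).Additive] [Pretriangulated T]
  {M : ℕ → ObjectProperty S} {F : S ⥤ T} [F.CommShift ℤ] [F.Additive]

lemma LPrimeBall.lPrime {n : ℕ} {X : T} (h : LPrimeBall M F n X) : LPrime M F X :=
  let ⟨a, ha, _, h⟩ := h
  ⟨a, ha, h⟩

lemma CompactlySupported.of_iso {G G' : ModCat S} (e : G ≅ G') (h : CompactlySupported M G) :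
    CompactlySupported M G' :=
  let ⟨i, hi⟩ := h
  ⟨i, ((M i).map (Y S)).rightOrthogonal.prop_of_iso e hi⟩

/-- An object orthogonal to `F (M n)` is orthogonal to the homotopy colimits of sequences in
`M (n + 1)`: such a homotopy colimit is built from the coproduct of the terms and its suspension. -/
lemma rightOrthogonal_lPrimeBall (hM : IsGoodMetric M) {n : ℕ} {Z : T}
    (h : ∀ x, M n x → ∀ y : F.obj x ⟶ Z, y = 0) : (LPrimeBall M F (n + 1)).rightOrthogonal Z := by
  rintro X f ⟨a, -, haM, H, ⟨e⟩⟩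
  rw [← cancel_epi e.hom, comp_zero]
  refine H.hom_eq_zero (fun i => h _ (hM.anti _ _ (haM i))) (fun i f => ?_) _
  rw [← cancel_epi ((F.commShiftIso (1 : ℤ)).hom.app (a.obj i)), comp_zero]
  exact h _ (hM.shift_pos _ _ (haM i)) _

lemma rightOrthogonal_lBall {n : ℕ} {Z : T} (h : ∀ x, M n x → ∀ y : F.obj x ⟶ Z, y = 0) :
    (LBall M n).rightOrthogonal ((restrictedYoneda F).obj Z) := by
  rintro G f ⟨a, ι, -, haM, ⟨hG⟩⟩
  refine hG.hom_ext fun i => ?_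
  exact ((forall_yoneda_hom_eq_zero_iff (a.obj i) Z).2 (h _ (haM i)) (ι.app i ≫ f)).trans
    comp_zero.symm

lemma eq_zero_of_rightOrthogonal_lBall (hM : IsGoodMetric M) {n : ℕ} {Z : T}
    (h : (LBall M n).rightOrthogonal ((restrictedYoneda F).obj Z)) {x : S} (hx : M n x)
    (y : F.obj x ⟶ Z) : y = 0 :=
  (forall_yoneda_hom_eq_zero_iff x Z).1 (fun ψ => h ψ ⟨(Functor.const ℕ).obj x,
    (constCocone x).ι, isCauchy_const hM x, fun _ => hx, ⟨isColimitConstCocone x⟩⟩) y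

/-- If the metric is excellent, the fibre of `F B ⟶ hocolim F(d_*)` is approximated by the fibres of
the maps `B ⟶ d i`, which lie in `M m` for a map of type `m + 1`. -/
lemma exists_triangle_of_isExcellentMetric (hM : IsVeryGoodMetric M) (hsum : SummandClosed M)
    (hF : IsGoodExtension M F) (hex : IsExcellentMetric M) (m : ℕ) :
    ∃ n : ℕ, 0 < n ∧ ∀ B : S, ∃ (A C : T) (f : A ⟶ F.obj B) (g : F.obj B ⟶ C)
      (h : C ⟶ A⟦(1 : ℤ)⟧), Triangle.mk f g h ∈ distTriang T ∧ LPrimeBall M F m A ∧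
        SPrime M F C ∧ (LPrimeBall M F n).rightOrthogonal C := by
  obtain ⟨n, -, hn⟩ := hex.coapprox (m + 1)
  refine ⟨n + 1, n.succ_pos, fun B => ?_⟩
  obtain ⟨d, D, -, hd, ⟨hD⟩, ⟨p, q, hp, hq, f, -, hf⟩, ⟨-, hDc⟩, hDo⟩ := hn B
  obtain ⟨H⟩ := hF.nonempty_hocolim hd
  obtain ⟨hH⟩ := hF.isColimit d hd H
  let e : D.pt ≅ (restrictedYoneda F).obj H.pt := hD.coconePointUniqueUpToIso hH
  obtain ⟨c, g, h, hc⟩ := exists_isCompletion hM hsum (hd.comp hq) (X := B) f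
  obtain ⟨K, hK⟩ := hf c g h hc
  let f' : ∀ i, B ⟶ d.obj (q i) := fun i => f.app i
  have hf' : ∀ i, f' 0 ≫ d.map (homOfLE (hq.monotone (Nat.zero_le i))) = f' i := fun i =>
    (f.naturality (homOfLE (Nat.zero_le i))).symm.trans (Category.id_comp _)
  let φ : F.obj B ⟶ H.pt := F.map (f' 0) ≫ H.cocone.ι.app (q 0)
  have hφ : ∀ i, F.map (f' i) ≫ H.cocone.ι.app (q i) = φ := fun i => by
    rw [← hf' i]
    exact H.map_comp_ι (f' 0) (hq.monotone (Nat.zero_le i))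
  obtain ⟨A, α, γ, hT⟩ := distinguished_cocone_triangle₁ φ
  refine ⟨A, H.pt, α, φ, γ, hT, ?_, ⟨⟨d, hd, H, ⟨Iso.refl _⟩⟩, hDc.of_iso e⟩,
    rightOrthogonal_lPrimeBall hM.toIsGoodMetric fun x hx => eq_zero_of_rightOrthogonal_lBall
      hM.toIsGoodMetric ((LBall M n).rightOrthogonal.prop_of_iso e hDo) hx⟩
  refine exists_hocolim_iso hM hsum hF (M m)
    ((isGenerated_obj B).of_distTriang₁ hT (isGenerated_hocolim H)) fun k => ?_
  obtain ⟨N, hN⟩ := hF.exists_isApprox hM.toIsGoodMetric hd H (k + 1)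
  let i := max K N
  obtain ⟨u, hu⟩ := (hN (q i) ((le_max_right K N).trans (hq.id_le i))).exists_fiber
    hM.toIsGoodMetric hF hT (inv_rot_of_distTriang _ (hc.dist i)) (hφ i)
  exact ⟨_, u, hM.shift_neg _ _ (hK i (le_max_left K N)), hu⟩

/-- Suppose that the fibre of `F B ⟶ C` is the homotopy colimit of a Cauchy sequence `a_*` in
`M (m + 1)`, and that `C` is the homotopy colimit of `d_*`. Then, up to a small error, the fibre `k`
of a factorization `B ⟶ d i` with `i` large agrees with `a j` for `j` large: the approximation of
the fibre by `k` factors through `a j` by a map with small cone. -/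
lemma exists_cone_mem_of_triangle (hM : IsVeryGoodMetric M) (hsum : SummandClosed M)
    (hF : IsGoodExtension M F) {m : ℕ} {A C : T} {B : S} {α : A ⟶ F.obj B} {φ : F.obj B ⟶ C}
    {γ : C ⟶ A⟦(1 : ℤ)⟧} (hT : Triangle.mk α φ γ ∈ distTriang T)
    (hA : LPrimeBall M F (m + 1) A) {d : ℕ ⥤ S} (hd : IsCauchy M d) (H : Hocolim (d ⋙ F))
    (e : H.pt ≅ C) :
    ∃ N, ∀ i, N ≤ i → ∀ b : B ⟶ d.obj i, F.map b ≫ H.cocone.ι.app i ≫ e.hom = φ →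
      ∀ (c : S) (g : d.obj i ⟶ c) (h : c ⟶ B⟦(1 : ℤ)⟧), Triangle.mk b g h ∈ distTriang S →
        M m c := by
  have := hF.full
  have := hF.faithful
  have hM' := hM.toIsGoodMetric
  obtain ⟨a, ha, haM, H', ⟨e'⟩⟩ := hA
  obtain ⟨hH'⟩ := hF.isColimit a ha H'
  obtain ⟨n, hn⟩ := exists_cone_mem hM hsum (m + 2)
  obtain ⟨N, hN⟩ := hF.exists_isApprox hM' hd H (n + 1)
  obtain ⟨N', hN'⟩ := hF.exists_isApprox hM' ha H' n
  refine ⟨N, fun i hi b hb c g h hc => ?_⟩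
  obtain ⟨u, hu⟩ := ((hN i hi).comp_iso e).exists_fiber hM' hF hT (inv_rot_of_distTriang _ hc) hb
  obtain ⟨j, t, ht⟩ := exists_lift_of_isColimit hH' (u ≫ e'.inv)
  let l := max j N'
  let t' : c⟦(-1 : ℤ)⟧ ⟶ a.obj l := t ≫ a.map (homOfLE (le_max_left j N'))
  have ht' : F.map t' ≫ H'.cocone.ι.app l = u ≫ e'.inv :=
    (H'.map_comp_ι t (le_max_left j N')).trans ht
  have ht'' : ∀ q, (M n).leftOrthogonal q → HomBij q t' := fun q hq =>
    (HomBij.map_iff F).1 ((hN' l (le_max_right j N') q hq).of_comp_right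
      (ht' ▸ hu.comp_iso e'.symm q hq))
  obtain ⟨p, g', h', hp⟩ := distinguished_cocone_triangle t'
  have hk : M (m + 1) (c⟦(-1 : ℤ)⟧) := hM.ext (m + 1) _ (inv_rot_of_distTriang _ hp)
    (hM.shift_neg _ _ (hn _ _ t' ht'' p g' h' hp)) (haM l)
  exact hM'.of_iso m ((shiftFunctorCompIsoId S (-1 : ℤ) 1 (by simp)).app c) (hM.shift_pos _ _ hk)

/-- A factorization `B ⟶ d i` of `F B ⟶ C = hocolim F(d_*)`, continued along `d_*`, is a map from
the constant sequence to a tail of `d_*`, and it is of type `m` by `exists_cone_mem_of_triangle`. -/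
lemma isExcellentMetric_of_exists_triangle (hM : IsVeryGoodMetric M) (hsum : SummandClosed M)
    (hF : IsGoodExtension M F)
    (hT : ∀ m : ℕ, 0 < m → ∃ n : ℕ, ∀ B : S, ∃ (A C : T) (f : A ⟶ F.obj B) (g : F.obj B ⟶ C)
      (h : C ⟶ A⟦(1 : ℤ)⟧), Triangle.mk f g h ∈ distTriang T ∧ LPrimeBall M F m A ∧
        SPrime M F C ∧ (LPrimeBall M F n).rightOrthogonal C) :
    IsExcellentMetric M := by
  refine ⟨hM, fun m => ?_⟩
  obtain ⟨n₀, hn₀⟩ := hT (m + 1) m.succ_pos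
  -- An excellent metric requires an index larger than `m`; enlarging `n₀` shrinks `M n₀`.
  refine ⟨max n₀ (m + 1), m.lt_succ_self.trans_le (le_max_right _ _), fun X => ?_⟩
  obtain ⟨A, C, α, φ, γ, hT, hA, ⟨⟨d, hd, H, ⟨e'⟩⟩, hCc⟩, hCo⟩ := hn₀ X
  let e : H.cocone.pt ≅ C := e'
  obtain ⟨hH⟩ := hF.isColimit d hd H
  obtain ⟨i₀, b₀, hb₀⟩ := exists_lift_of_isColimit hH (φ ≫ e.inv)
  obtain ⟨N, hN⟩ := exists_cone_mem_of_triangle hM hsum hF hT hA hd H e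
  let q : ℕ → ℕ := fun i => i₀ + i
  have hq : StrictMono q := fun i j hij => Nat.add_lt_add_left hij i₀
  let b : ∀ i, X ⟶ d.obj (q i) := fun i => b₀ ≫ d.map (homOfLE (Nat.le_add_right i₀ i))
  have hb : ∀ i, F.map (b i) ≫ H.cocone.ι.app (q i) = φ ≫ e.inv := fun i =>
    (H.map_comp_ι b₀ (Nat.le_add_right i₀ i)).trans hb₀
  let f : (Functor.const ℕ).obj X ⟶ hq.monotone.functor ⋙ d :=
    { app := b
      naturality := fun i j hij => by
        have h := d.map_comp (homOfLE (Nat.le_add_right i₀ i))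
          (homOfLE (hq.monotone (leOfHom hij)))
        exact (Category.id_comp _).trans
          ((congrArg (b₀ ≫ ·) h).trans (Category.assoc _ _ _).symm) }
  refine ⟨d, comparisonCocone F H,
    (yonedaComparison F).app X ≫ (restrictedYoneda F).map (φ ≫ e.inv), hd, ⟨hH⟩,
    ⟨id, q, strictMono_id, hq, f, fun i => ?_, fun c g h hc => ⟨N, fun i hi => ?_⟩⟩,
    ⟨⟨d, (comparisonCocone F H).ι, hd, ⟨hH⟩⟩, hCc.of_iso ((restrictedYoneda F).mapIso e.symm)⟩,
    rightOrthogonal_lBall fun x hx y => ?_⟩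
  · refine (Category.id_comp _).trans ?_
    rw [← hb i]
    exact (map_comp_yonedaComparison (b i) (H.cocone.ι.app (q i))).symm
  · refine hN (q i) (hi.trans (hq.id_le i)) (b i) ?_ (c.obj i) (g.app i) (h.app i) (hc.dist i)
    exact (Category.assoc _ _ _).symm.trans ((congrArg (· ≫ e.hom) (hb i)).trans (by simp))
  · rw [← cancel_mono e.hom, zero_comp]
    exact hCo _ (lPrimeBall_obj hM hsum hF
      (hM.toIsGoodMetric.of_le (le_max_left n₀ (m + 1)) hx))

end Main

end MetricTriang

theorem proposition6
    {S : Type u₁} [Category.{v} S] [HasZeroObject S] [HasShift S ℤ] [Preadditive S]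
    [∀ n : ℤ, (shiftFunctor S n).Additive] [Pretriangulated S] [IsTriangulated S]
    {T : Type u₂} [Category.{v} T] [HasZeroObject T] [HasShift T ℤ] [Preadditive T]
    [∀ n : ℤ, (shiftFunctor T n).Additive] [Pretriangulated T] [IsTriangulated T]
    (M : ℕ → ObjectProperty S) (hM : MetricTriang.IsVeryGoodMetric M)
    (hsum : MetricTriang.SummandClosed M)
    (F : S ⥤ T) [F.CommShift ℤ] [F.Additive] (hF : MetricTriang.IsGoodExtension M F) :
    MetricTriang.IsExcellentMetric M ↔
      ∀ m : ℕ, 0 < m → ∃ n : ℕ, 0 < n ∧ ∀ B : S,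
        ∃ (A C : T) (f : A ⟶ F.obj B) (g : F.obj B ⟶ C) (h : C ⟶ A⟦(1 : ℤ)⟧),
          Triangle.mk f g h ∈ distTriang T ∧
          MetricTriang.LPrime M F A ∧ MetricTriang.LPrime M F (F.obj B) ∧
          MetricTriang.LPrime M F C ∧
          MetricTriang.LPrimeBall M F m A ∧
          MetricTriang.SPrime M F C ∧
          (MetricTriang.LPrimeBall M F n).rightOrthogonal C := by
  constructor
  · intro hex m _
    obtain ⟨n, hn, h⟩ := MetricTriang.exists_triangle_of_isExcellentMetric hM hsum hF hex m
    refine ⟨n, hn, fun B => ?_⟩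
    obtain ⟨A, C, f, g, k, hT, hA, hC, hCo⟩ := h B
    exact ⟨A, C, f, g, k, hT, hA.lPrime, MetricTriang.lPrime_obj hM hsum hF B, hC.1, hA, hC, hCo⟩
  · intro h
    refine MetricTriang.isExcellentMetric_of_exists_triangle hM hsum hF fun m hm => ?_
    obtain ⟨n, -, hn⟩ := h m hm
    refine ⟨n, fun B => ?_⟩
    obtain ⟨A, C, f, g, k, hT, -, -, -, hA, hC, hCo⟩ := hn B
    exact ⟨A, C, f, g, k, hT, hA, hC, hCo⟩
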